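/- Let $q\ge 3$ be a prime power with $q\neq 4$, let $k\ge 6$ be an integer, and put $t=\lfloor (k+2)/4\rfloor$. Let $D(k,q)$ be the bipartite graph whose vertex set is the disjoint union of two copies of $\mathbb F_q^k$, a set of points $(p)=(p_1,\dots,p_k)$ and a set of lines $[l]=[l_1,\dots,l_k]$, in which a point $(p)$ and a line $[l]$ are adjacent if and only if $$p_2+l_2=p_1l_1,\qquad p_3+l_3=p_1l_2,$$ and, for $4\le i\le k$, $p_i+l_i=p_{i-2}l_1$ if $i\equiv 0,1\pmod 4$ and $p_i+l_i=p_1l_{i-2}$ if $i\equiv 2,3\pmod 4$ (there are no other edges). For a vertex $u$ let $\vec a(u)=\langle a_2(u),\dots,a_t(u)\rangle\in\mathbb F_q^{t-1}$ be its invariant vector, where $$a_2((p))=-p_1p_4+p_2^2+p_5-p_6,\qquad a_2([l])=-l_1l_3+l_2^2-l_5+l_6,$$ and, for $3\le r\le t$, $$a_r((p))=(-1)^{r-1}\Big[p_1p_{4r-4}-p_2p_{4r-6}-p_2p_{4r-7}+p_3p_{4r-8}-p_{4r-3}+p_{4r-2}+\sum_{i=2}^{r-2}\big(-p_{4i-3}p_{4(r-i)-2}+p_{4i-1}p_{4(r-i)-4}\big)\Big],$$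 $$a_r([l])=(-1)^{r-1}\Big[l_1l_{4r-5}-l_2l_{4r-6}-l_2l_{4r-7}+l_3l_{4r-8}+l_{4r-3}-l_{4r-2}+\sum_{i=2}^{r-2}\big(-l_{4i-3}l_{4(r-i)-2}+l_{4i-1}l_{4(r-i)-4}\big)\Big].$$ Let $C$ be the connected component of $D(k,q)$ that contains the point $(0)=(0,\dots,0)$. If $v$ is a vertex (a point or a line) of $D(k,q)$ with $\vec a(v)=\vec 0$, then $v\in V(C)$. -/

import Mathlib

namespace DGraph

/-- The vertices of `D(k, q)` over the field `F` with `q` elements: the disjoint union of two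
copies of `F ^ k`, whose elements are called points and lines. -/
inductive Vertex (F : Type*) (k : ℕ) where
  | point (p : Fin k → F) : Vertex F k
  | line (l : Fin k → F) : Vertex F k

variable {F : Type*} [Field F] {k : ℕ}

/-- The coordinate `x_i` of a vector `x = (x_1, …, x_k)`, numbered from `1` to `k`.
(The value `0` for `i = 0` or `i > k` is never used by the definitions below.) -/
def coord (x : Fin k → F) (i : ℕ) : F :=
  if h : 1 ≤ i ∧ i ≤ k then x ⟨i - 1, by omega⟩ else 0

/-- The right-hand sides of the defining equations of `D(k, q)`:
`f_2 = p_1 l_1`, `f_3 = p_1 l_2` and, for `i ≥ 4`, `f_i = p_{i-2} l_1` if `i ≡ 0, 1 (mod 4)`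
and `f_i = p_1 l_{i-2}` if `i ≡ 2, 3 (mod 4)`. -/
def rhs (p l : Fin k → F) (i : ℕ) : F :=
  if i = 2 then coord p 1 * coord l 1
  else if i = 3 then coord p 1 * coord l 2
  else if i % 4 = 0 ∨ i % 4 = 1 then coord p (i - 2) * coord l 1
  else coord p 1 * coord l (i - 2)

/-- Incidence of a point and a line: `p_i + l_i = f_i` for `2 ≤ i ≤ k`. -/
def Incident (p l : Fin k → F) : Prop :=
  ∀ i : ℕ, 2 ≤ i → i ≤ k → coord p i + coord l i = rhs p l i

/-- The bipartite graph `D(k, q)`, where `q` is the number of elements of `F`. -/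
def graph (F : Type*) [Field F] (k : ℕ) : SimpleGraph (Vertex F k) where
  Adj
    | .point p, .line l => Incident p l
    | .line l, .point p => Incident p l
    | .point _, .point _ => False
    | .line _, .line _ => False
  symm := ⟨by rintro (p | l) (p' | l') h <;> exact h⟩
  loopless := ⟨by rintro (p | l) h <;> exact h⟩

/-- The number `t = ⌊(k + 2) / 4⌋`. -/
def tNum (k : ℕ) : ℕ := (k + 2) / 4

/-- The invariant `a_r` of a point; it is used for `2 ≤ r ≤ t` only. -/
def pointInvariant (p : Fin k → F) (r : ℕ) : F :=
  if r = 2 then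
    -(coord p 1 * coord p 4) + coord p 2 ^ 2 + coord p 5 - coord p 6
  else
    (-1) ^ (r - 1) *
      (coord p 1 * coord p (4 * r - 4) - coord p 2 * coord p (4 * r - 6)
        - coord p 2 * coord p (4 * r - 7) + coord p 3 * coord p (4 * r - 8)
        - coord p (4 * r - 3) + coord p (4 * r - 2)
        + ∑ i ∈ Finset.Icc 2 (r - 2),
            (-(coord p (4 * i - 3) * coord p (4 * (r - i) - 2))
              + coord p (4 * i - 1) * coord p (4 * (r - i) - 4)))

/-- The invariant `a_r` of a line; it is used for `2 ≤ r ≤ t` only. -/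
def lineInvariant (l : Fin k → F) (r : ℕ) : F :=
  if r = 2 then
    -(coord l 1 * coord l 3) + coord l 2 ^ 2 - coord l 5 + coord l 6
  else
    (-1) ^ (r - 1) *
      (coord l 1 * coord l (4 * r - 5) - coord l 2 * coord l (4 * r - 6)
        - coord l 2 * coord l (4 * r - 7) + coord l 3 * coord l (4 * r - 8)
        + coord l (4 * r - 3) - coord l (4 * r - 2)
        + ∑ i ∈ Finset.Icc 2 (r - 2),
            (-(coord l (4 * i - 3) * coord l (4 * (r - i) - 2))
              + coord l (4 * i - 1) * coord l (4 * (r - i) - 4)))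

/-- The invariant vector `⟨a_2(v), …, a_t(v)⟩` of a vertex `v`. -/
def invariantVector : Vertex F k → (Finset.Icc 2 (tNum k) → F)
  | .point p => fun r => pointInvariant p r
  | .line l => fun r => lineInvariant l r

/-- The component `C` of `D(k, q)` that contains the point `(0)`. -/
def zeroComponent (F : Type*) [Field F] (k : ℕ) : (graph F k).ConnectedComponent :=
  (graph F k).connectedComponentMk (Vertex.point 0)

end DGraph

/-! Encode a point as a matrix (A B; C D) of power series, congruent to 1 modulo X, with A_j =
p_{4j-2}, C_j = p_{4j}, B_1 = -p_1, D_1 = -p_2 and, for j ≥ 2, B_j = -p_{4j-5}, D_j = -p_{4j-3}. Up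
to sign, the invariants a_2, …, a_t are the coefficients of the determinant in degrees 2, …, t. So a
point with zero invariants comes from some g in SL_2(F⟦X⟧) with g ≡ 1 mod X
(`exists_mat_of_pointInvariant`).

A walk of length two through a line with l_1 = y that raises p_1 by a is left multiplication by 1 +
a X N(y), where N(y) is the column (1, y) times the row (y, -1) (`incident_gen_mul`). Only finitely
many coefficients are visible, so it suffices that these elements generate a dense subgroup of the
congruence subgroup (`exists_mem_genGroup_approx`).

Density is tested degree by degree: the matrices A for which some 1 + A X^m + ⋯ lies in the group
must fill sl_2(F) (`fullLeads`). In degree one, N(0), N(1), N(c) span. If 2 ≠ 0, brackets with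
degree one give all higher degrees. In characteristic two, brackets of traceless matrices are only
scalars, and second-order terms are needed: degree two comes from interpolation at five nodes, which
is where q = 4 drops out, and degree m + 2 from commutators whose leading terms cancel.

A line is replaced by its neighbour with p_1 = 0, which has the same invariants
(`pointInvariant_footCoord`). -/

namespace DGraph

open PowerSeries Matrix

variable {F : Type*} [Field F]

/-! ### Matrices over power series and their low coefficients. -/

/-- The special linear group of degree two over the ring of formal power series. -/
abbrev SLSeries (F : Type*) [Field F] := Matrix.SpecialLinearGroup (Fin 2) F⟦X⟧

/-- The matrix of an element of the special linear group. -/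
def mat (g : SLSeries F) : Matrix (Fin 2) (Fin 2) F⟦X⟧ := g.1

theorem mat_mul (g h : SLSeries F) : mat (g * h) = mat g * mat h := rfl

theorem mat_one : mat (1 : SLSeries F) = 1 := rfl

theorem det_mat (g : SLSeries F) : (mat g).det = 1 := g.2

/-- A nilpotent matrix of rank one. -/
def nilp (y : F) : Matrix (Fin 2) (Fin 2) F := !![y, -1; y ^ 2, -y]

/-- The unipotent element `1 + a X N(y)`. -/
noncomputable def gen (a y : F) : SLSeries F :=
  ⟨!![1 + X * C (a * y), -(X * C a); X * C (a * y ^ 2), 1 - X * C (a * y)], by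
    simp only [det_fin_two_of, map_mul, map_pow]; ring⟩

/-- The group generated by the elements `1 + a X N(y)`. -/
noncomputable def genGroup (F : Type*) [Field F] : Subgroup (SLSeries F) :=
  Subgroup.closure (Set.range fun w : F × F => gen w.1 w.2)

theorem gen_mem (a y : F) : gen a y ∈ genGroup F :=
  Subgroup.subset_closure ⟨(a, y), rfl⟩

/-- Entrywise coefficient of a matrix of power series. -/
noncomputable def mcoeff (n : ℕ) (M : Matrix (Fin 2) (Fin 2) F⟦X⟧) : Matrix (Fin 2) (Fin 2) F :=
  M.map (coeff n)

theorem mcoeff_add (n : ℕ) (M N : Matrix (Fin 2) (Fin 2) F⟦X⟧) :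
    mcoeff n (M + N) = mcoeff n M + mcoeff n N := by
  ext i j; simp [mcoeff]

theorem mcoeff_sub (n : ℕ) (M N : Matrix (Fin 2) (Fin 2) F⟦X⟧) :
    mcoeff n (M - N) = mcoeff n M - mcoeff n N := by
  ext i j; simp [mcoeff]

theorem mcoeff_zero_mul (M N : Matrix (Fin 2) (Fin 2) F⟦X⟧) :
    mcoeff 0 (M * N) = mcoeff 0 M * mcoeff 0 N := by
  ext i j; simp [mcoeff, Matrix.mul_apply]

theorem coeff_one_mul' (f g : F⟦X⟧) :
    coeff 1 (f * g) = coeff 0 f * coeff 1 g + coeff 1 f * coeff 0 g := by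
  rw [PowerSeries.coeff_mul, Finset.Nat.antidiagonal_succ]; simp

theorem mcoeff_one_mul (M N : Matrix (Fin 2) (Fin 2) F⟦X⟧) :
    mcoeff 1 (M * N) = mcoeff 0 M * mcoeff 1 N + mcoeff 1 M * mcoeff 0 N := by
  ext i j
  simp only [mcoeff, Matrix.mul_apply, Matrix.map_apply, Matrix.add_apply, Fin.sum_univ_two,
    map_add, coeff_one_mul']
  ring

theorem mcoeff_zero_one : mcoeff 0 (1 : Matrix (Fin 2) (Fin 2) F⟦X⟧) = 1 := by
  ext i j; fin_cases i <;> fin_cases j <;> simp [mcoeff]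

theorem mcoeff_one_one : mcoeff 1 (1 : Matrix (Fin 2) (Fin 2) F⟦X⟧) = 0 := by
  ext i j; fin_cases i <;> fin_cases j <;> simp [mcoeff, PowerSeries.coeff_one]

theorem mcoeff_X_pow_smul (m n : ℕ) (M : Matrix (Fin 2) (Fin 2) F⟦X⟧) :
    mcoeff (n + m) ((X : F⟦X⟧) ^ m • M) = mcoeff n M := by
  ext i j; simp [mcoeff]

theorem mcoeff_X_pow_smul_of_lt {m n : ℕ} (h : n < m) (M : Matrix (Fin 2) (Fin 2) F⟦X⟧) :
    mcoeff n ((X : F⟦X⟧) ^ m • M) = 0 := by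
  ext i j; simp [mcoeff, PowerSeries.coeff_X_pow_mul', h]

theorem mcoeff_zero_X_smul (M : Matrix (Fin 2) (Fin 2) F⟦X⟧) :
    mcoeff 0 ((X : F⟦X⟧) • M) = 0 := by
  ext i j; simp [mcoeff]

theorem mcoeff_one_X_smul (M : Matrix (Fin 2) (Fin 2) F⟦X⟧) :
    mcoeff 1 ((X : F⟦X⟧) • M) = mcoeff 0 M := by
  simpa using mcoeff_X_pow_smul 1 0 M

/-- A matrix of power series with vanishing constant term is divisible by `X`. -/
theorem exists_eq_X_smul {M : Matrix (Fin 2) (Fin 2) F⟦X⟧} (h : mcoeff 0 M = 0) :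
    ∃ W : Matrix (Fin 2) (Fin 2) F⟦X⟧, M = (X : F⟦X⟧) • W ∧ mcoeff 0 W = mcoeff 1 M := by
  have hd : ∀ i j, (X : F⟦X⟧) ∣ M i j := fun i j => by
    rw [PowerSeries.X_dvd_iff]
    have := congrFun (congrFun h i) j
    simpa [mcoeff] using this
  choose w hw using hd
  have hM : M = (X : F⟦X⟧) • Matrix.of w := by
    ext1 i j; simpa using hw i j
  refine ⟨Matrix.of w, hM, ?_⟩
  rw [hM, mcoeff_one_X_smul]

/-! ### The graded Lie algebra of leading terms. -/

/-- `A` is the leading term of order `m` of `g = 1 + A X ^ m + ⋯`. -/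
def HasLead (m : ℕ) (A : Matrix (Fin 2) (Fin 2) F) (g : SLSeries F) : Prop :=
  ∃ R : Matrix (Fin 2) (Fin 2) F⟦X⟧, mat g = 1 + (X : F⟦X⟧) ^ m • R ∧
    mcoeff 0 R = A

/-- The leading terms of order `m` that occur in `genGroup F`. -/
def leads (F : Type*) [Field F] (m : ℕ) : Set (Matrix (Fin 2) (Fin 2) F) :=
  {A | ∃ g ∈ genGroup F, HasLead m A g}

theorem HasLead.mul {m : ℕ} (hm : 1 ≤ m) {A B : Matrix (Fin 2) (Fin 2) F} {g h : SLSeries F}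
    (hg : HasLead m A g) (hh : HasLead m B h) : HasLead m (A + B) (g * h) := by
  obtain ⟨R, hR, rfl⟩ := hg
  obtain ⟨S, hS, rfl⟩ := hh
  refine ⟨R + S + (X : F⟦X⟧) ^ m • (R * S), ?_, ?_⟩
  · rw [mat_mul, hR, hS]
    simp only [mul_add, add_mul, one_mul, mul_one, smul_add, smul_mul_assoc, mul_smul_comm]
    abel
  · rw [mcoeff_add, mcoeff_add, mcoeff_X_pow_smul_of_lt (by omega), add_zero]

theorem leads_add {m : ℕ} (hm : 1 ≤ m) {A B : Matrix (Fin 2) (Fin 2) F}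
    (hA : A ∈ leads F m) (hB : B ∈ leads F m) : A + B ∈ leads F m := by
  obtain ⟨g, hg, hg'⟩ := hA
  obtain ⟨h, hh, hh'⟩ := hB
  exact ⟨g * h, mul_mem hg hh, hg'.mul hm hh'⟩

theorem HasLead.mcoeff_zero {m : ℕ} (hm : 1 ≤ m) {A : Matrix (Fin 2) (Fin 2) F} {g : SLSeries F}
    (hg : HasLead m A g) : mcoeff 0 (mat g) = 1 := by
  obtain ⟨R, hR, -⟩ := hg
  rw [hR, mcoeff_add, mcoeff_X_pow_smul_of_lt (by omega), mcoeff_zero_one, add_zero]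

theorem mcoeff_zero_inv {g : SLSeries F} (hg : mcoeff 0 (mat g) = 1) :
    mcoeff 0 (mat g⁻¹) = 1 := by
  have h := mcoeff_zero_mul (mat g) (mat g⁻¹)
  rw [← mat_mul, mul_inv_cancel, mat_one, mcoeff_zero_one,
    hg, one_mul] at h
  exact h.symm

/-- The commutator of `1 + P` and `1 + Q` in terms of the additive commutator of `P` and `Q`. -/
theorem coe_commutator {g h : SLSeries F} {P Q : Matrix (Fin 2) (Fin 2) F⟦X⟧}
    (hg : mat g = 1 + P) (hh : mat h = 1 + Q) :
    mat (g * h * (h * g)⁻¹) =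
      1 + (P * Q - Q * P) * mat (h * g)⁻¹ := by
  have h1 : mat (g * h) =
      mat (h * g) + (P * Q - Q * P) := by
    rw [mat_mul, mat_mul, hg, hh]; noncomm_ring
  rw [mat_mul, h1, add_mul, ← mat_mul, mul_inv_cancel,
    mat_one]

/-- A group commutator is 1 + (PQ - QP)(hg)⁻¹ and (hg)⁻¹ ≡ 1 mod X, so its term of degree m + n is
the additive commutator. -/
theorem leads_bracket {m n : ℕ} (hm : 1 ≤ m) (hn : 1 ≤ n) {A B : Matrix (Fin 2) (Fin 2) F}
    (hA : A ∈ leads F m) (hB : B ∈ leads F n) : A * B - B * A ∈ leads F (m + n) := by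
  obtain ⟨g, hg, hg'⟩ := hA
  obtain ⟨h, hh, hh'⟩ := hB
  refine ⟨g * h * (h * g)⁻¹, mul_mem (mul_mem hg hh) (inv_mem (mul_mem hh hg)), ?_⟩
  have h0 : mcoeff 0 (mat (h * g)⁻¹) = 1 := by
    apply mcoeff_zero_inv
    rw [mat_mul, mcoeff_zero_mul, hg'.mcoeff_zero hm, hh'.mcoeff_zero hn, mul_one]
  obtain ⟨R, hR, rfl⟩ := hg'
  obtain ⟨S, hS, rfl⟩ := hh'
  refine ⟨(R * S - S * R) * mat (h * g)⁻¹, ?_, ?_⟩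
  · rw [coe_commutator hR hS, ← smul_mul_assoc]
    congr 2
    simp only [smul_mul_assoc, mul_smul_comm, smul_sub, smul_smul, pow_add]
    rw [mul_comm (X ^ n : F⟦X⟧)]
  · rw [mcoeff_zero_mul, h0, mul_one, mcoeff_sub, mcoeff_zero_mul, mcoeff_zero_mul]

theorem coe_gen (a y : F) : mat (gen a y) =
    1 + (X : F⟦X⟧) • (a • nilp y).map C := by
  ext1 i j; fin_cases i <;> fin_cases j <;> simp [mat, gen, nilp, sub_eq_add_neg]

theorem mcoeff_zero_map_C (A : Matrix (Fin 2) (Fin 2) F) : mcoeff 0 (A.map C) = A := by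
  ext i j; simp [mcoeff]

theorem mcoeff_one_map_C (A : Matrix (Fin 2) (Fin 2) F) : mcoeff 1 (A.map C) = 0 := by
  ext i j; simp [mcoeff]

theorem hasLead_gen (a y : F) : HasLead 1 (a • nilp y) (gen a y) :=
  ⟨(a • nilp y).map C, by rw [pow_one]; exact coe_gen a y, mcoeff_zero_map_C _⟩

/-- Every traceless matrix is a leading term of order `m`. -/
def FullLeads (F : Type*) [Field F] (m : ℕ) : Prop :=
  ∀ α β γ : F, !![α, β; γ, -α] ∈ leads F m

/-- N(0), N(1), N(c) form a basis of sl_2: their determinant in the standard basis is c(c - 1) up to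
sign, hence the need for a third field element. -/
theorem fullLeads_one {c : F} (h0 : c ≠ 0) (h1 : c ≠ 1) : FullLeads F 1 := by
  intro α β γ
  have hc : c * (c - 1) ≠ 0 := mul_ne_zero h0 (sub_ne_zero.2 h1)
  obtain ⟨w, hw⟩ : ∃ w : F, w * (c * (c - 1)) = γ - α :=
    ⟨(γ - α) / (c * (c - 1)), div_mul_cancel₀ _ hc⟩
  have key : !![α, β; γ, -α] = (-β - (α - c * w) - w) • nilp 0 + (α - c * w) • nilp 1
      + w • nilp c := by
    ext i j; fin_cases i <;> fin_cases j <;> simp [nilp] <;>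
      first | ring1 | linear_combination -hw
  rw [key]
  exact leads_add le_rfl (leads_add le_rfl ⟨_, gen_mem _ _, hasLead_gen _ _⟩
    ⟨_, gen_mem _ _, hasLead_gen _ _⟩) ⟨_, gen_mem _ _, hasLead_gen _ _⟩

/-- [E₁₂, E₂₁] = H, while bracketing with H scales E₁₂ and E₂₁ by ±2, which is invertible here. -/
theorem FullLeads.succ_of_two_ne_zero (h2 : (2 : F) ≠ 0) (h1 : FullLeads F 1) {m : ℕ} (hm : 1 ≤ m)
    (h : FullLeads F m) : FullLeads F (m + 1) := by
  intro α β γ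
  have key : !![α, β; γ, -α] =
      (!![0, α; 0, -0] * !![0, 0; 1, -0] - !![0, 0; 1, -0] * !![0, α; 0, -0]) +
      (!![1, 0; 0, -1] * !![0, β / 2; -(γ / 2), -0] - !![0, β / 2; -(γ / 2), -0] * !![1, 0; 0, -1]) := by
    ext i j; fin_cases i <;> fin_cases j <;> simp <;> field_simp <;> norm_num
  rw [key]
  exact leads_add (by omega) (leads_bracket hm le_rfl (h _ _ _) (h1 _ _ _))
    (leads_bracket hm le_rfl (h _ _ _) (h1 _ _ _))

/-! ### Density by successive approximation. -/

theorem det_one_add (M : Matrix (Fin 2) (Fin 2) F⟦X⟧) : (1 + M).det = 1 + M.trace + M.det := by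
  simp [det_fin_two, trace_fin_two]; ring

/-- The trace of `R` if `1 + X ^ m R` has determinant one. -/
theorem trace_eq_of_mat_eq {m : ℕ} {g : SLSeries F} {R : Matrix (Fin 2) (Fin 2) F⟦X⟧}
    (h : mat g = 1 + (X : F⟦X⟧) ^ m • R) : R.trace = -((X : F⟦X⟧) ^ m * R.det) := by
  have h1 := det_mat g
  rw [h, det_one_add, trace_smul, det_smul, Fintype.card_fin, smul_eq_mul] at h1
  have h2 : (X : F⟦X⟧) ^ m * (R.trace + X ^ m * R.det) = 0 := by linear_combination h1
  have h3 := (mul_eq_zero.1 h2).resolve_left (pow_ne_zero _ PowerSeries.X_ne_zero)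
  linear_combination h3

theorem trace_mcoeff (n : ℕ) (R : Matrix (Fin 2) (Fin 2) F⟦X⟧) :
    (mcoeff n R).trace = coeff n R.trace := by
  simp [mcoeff, trace_fin_two]

theorem det_mcoeff_zero (R : Matrix (Fin 2) (Fin 2) F⟦X⟧) :
    (mcoeff 0 R).det = coeff 0 R.det := by
  simp [mcoeff, det_fin_two]

theorem exists_eq_of_trace_eq_zero {A : Matrix (Fin 2) (Fin 2) F} (h : A.trace = 0) :
    ∃ α β γ : F, A = !![α, β; γ, -α] := by
  refine ⟨A 0 0, A 0 1, A 1 0, ?_⟩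
  rw [trace_fin_two] at h
  ext i j; fin_cases i <;> fin_cases j <;> simp; linear_combination h

/-- If all traceless matrices are leading terms of every order, then the group generated by the
elements `1 + a X N(y)` is dense in the congruence subgroup modulo `X`. -/
theorem exists_mem_genGroup_approx (hF : ∀ m, 1 ≤ m → FullLeads F m) (g : SLSeries F)
    (hg : mcoeff 0 (mat g) = 1) (n : ℕ) :
    ∃ h ∈ genGroup F, ∃ R, mat g = mat h + (X : F⟦X⟧) ^ (n + 1) • R := by
  induction n with
  | zero =>
    have h0 : mcoeff 0 (mat g - 1) = 0 := by rw [mcoeff_sub, mcoeff_zero_one, hg, sub_self]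
    obtain ⟨W, hW, -⟩ := exists_eq_X_smul h0
    exact ⟨1, one_mem _, W, by rw [mat_one, zero_add, pow_one, ← hW, add_sub_cancel]⟩
  | succ n ih =>
    obtain ⟨h, hh, R, hR⟩ := ih
    have h1 : mat (g * h⁻¹) = 1 + (X : F⟦X⟧) ^ (n + 1) • (R * mat h⁻¹) := by
      rw [mat_mul, hR, add_mul, ← mat_mul, mul_inv_cancel, mat_one, smul_mul_assoc]
    -- Determinant one makes the leading error traceless, so an element of the group can cancel it.
    have htr : (mcoeff 0 (R * mat h⁻¹)).trace = 0 := by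
      rw [trace_mcoeff, trace_eq_of_mat_eq h1]
      simp
    obtain ⟨α, β, γ, hA⟩ := exists_eq_of_trace_eq_zero htr
    obtain ⟨u, hu, S, hS, hS0⟩ := hF (n + 1) (by omega) α β γ
    have h2 : mcoeff 0 (R * mat h⁻¹ - S) = 0 := by rw [mcoeff_sub, hA, hS0, sub_self]
    obtain ⟨W, hW, -⟩ := exists_eq_X_smul h2
    refine ⟨u * h, mul_mem hu hh, W * mat h, ?_⟩
    have h3 : mat (g * h⁻¹) = mat u + (X : F⟦X⟧) ^ (n + 1 + 1) • W := by
      rw [h1, hS, pow_succ _ (n + 1), mul_smul, ← hW, smul_sub]; abel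
    calc mat g = mat (g * h⁻¹) * mat h := by rw [← mat_mul, inv_mul_cancel_right]
      _ = _ := by rw [h3, add_mul, mat_mul, smul_mul_assoc]

/-! ### Characteristic two: commutators to second order. -/

/-- The commutator of `1 + a X N(y)` and an element with leading term `c E₂₁`, to second order,
in characteristic two. -/
theorem exists_commutator_second_order [CharP F 2] {m : ℕ} (hm : 1 ≤ m) (a y c : F)
    {g : SLSeries F} (hgm : g ∈ genGroup F) (hg : HasLead m !![0, 0; c, 0] g) :
    ∃ h ∈ genGroup F, ∃ T : Matrix (Fin 2) (Fin 2) F⟦X⟧,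
      mat h = 1 + (X : F⟦X⟧) ^ (m + 1) • T ∧ mcoeff 0 T = (a * c) • 1 ∧
      ∃ s : F, mcoeff 1 T = s • 1 + (a ^ 2 * c) • nilp y +
        (if m = 1 then a * c ^ 2 else 0) • !![0, 0; 1, 0] := by
  have two : (2 : F) = 0 := CharTwo.two_eq_zero
  have hg1 := hg.mcoeff_zero hm
  have hgi := mcoeff_zero_inv hg1
  obtain ⟨R, hR, hR0⟩ := hg
  set N : Matrix (Fin 2) (Fin 2) F⟦X⟧ := (a • nilp y).map C with hN
  have hNN : N * N = 0 := by
    rw [hN, ← C.mapMatrix_apply, ← map_mul]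
    have : nilp y * nilp y = 0 := by
      ext i j; fin_cases i <;> fin_cases j <;> simp [nilp] <;> ring
    simp [this]
  have hq : mat (gen a y) = 1 + (X : F⟦X⟧) • N := coe_gen a y
  have hqi : mat (gen a y)⁻¹ = 1 - (X : F⟦X⟧) • N := by
    have h1 : mat (gen a y)⁻¹ * mat (gen a y) = 1 := by rw [← mat_mul, inv_mul_cancel, mat_one]
    have h2 : mat (gen a y) * (1 - (X : F⟦X⟧) • N) = 1 := by
      rw [hq]
      simp only [add_mul, mul_sub, smul_mul_assoc, mul_smul_comm, hNN, one_mul, mul_one, smul_zero, add_zero, add_sub_cancel_right]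
    calc mat (gen a y)⁻¹ = mat (gen a y)⁻¹ * (mat (gen a y) * (1 - (X : F⟦X⟧) • N)) := by
          rw [h2, mul_one]
      _ = _ := by rw [← mul_assoc, h1, one_mul]
  refine ⟨gen a y * g * (g * gen a y)⁻¹,
    mul_mem (mul_mem (gen_mem a y) hgm) (inv_mem (mul_mem hgm (gen_mem a y))),
    (N * R - R * N - (X : F⟦X⟧) • (N * R * N)) * mat g⁻¹, ?_, ?_, ?_⟩
  · rw [coe_commutator hq hR, _root_.mul_inv_rev, mat_mul, hqi, ← mul_assoc, ← smul_mul_assoc]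
    congr 2
    simp only [mul_sub, sub_mul, smul_mul_assoc, mul_smul_comm, mul_one, smul_sub, smul_smul,
      mul_assoc, hNN, mul_zero, smul_zero, sub_zero]
    simp only [pow_succ, mul_comm]
  · rw [mcoeff_zero_mul, hgi, mul_one, mcoeff_sub, mcoeff_sub, mcoeff_zero_X_smul,
      mcoeff_zero_mul, mcoeff_zero_mul, mcoeff_zero_map_C, hR0]
    ext i j; fin_cases i <;> fin_cases j <;> simp [nilp] <;> grind
  · have hgi1 : mcoeff 1 (mat g⁻¹) = -(if m = 1 then (1 : F) else 0) • !![0, 0; c, 0] := by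
      have h1 : mcoeff 1 (mat g) = (if m = 1 then (1 : F) else 0) • !![0, 0; c, 0] := by
        rw [hR, mcoeff_add, mcoeff_one_one, zero_add, ← hR0]
        split_ifs with h
        · subst h; rw [pow_one, mcoeff_one_X_smul, one_smul]
        · rw [mcoeff_X_pow_smul_of_lt (by omega), zero_smul]
      have h2 := mcoeff_one_mul (mat g) (mat g⁻¹)
      rw [← mat_mul, mul_inv_cancel, mat_one, mcoeff_one_one, hg1, hgi, one_mul, mul_one, h1] at h2
      rw [neg_smul]
      exact eq_neg_of_add_eq_zero_left h2.symm
    -- The trace of R is -X^m det R, and det R has zero constant term because c E₂₁ is singular;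
    -- this matters when m = 1.
    have htr : (mcoeff 1 R).trace = 0 := by
      have hdet : coeff 0 R.det = 0 := by rw [← det_mcoeff_zero, hR0]; simp
      rw [trace_mcoeff, trace_eq_of_mat_eq hR]
      obtain ⟨n, rfl⟩ : ∃ n, m = n + 1 := ⟨m - 1, by omega⟩
      have hdet' : constantCoeff R.det = 0 := by simpa using hdet
      rw [map_neg, pow_succ', mul_assoc, coeff_one_mul']
      simp [hdet']
    obtain ⟨α, β, γ, hR1⟩ := exists_eq_of_trace_eq_zero htr
    -- In characteristic two the bracket of a N(y) with the traceless linear coefficient of R is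
    -- scalar; this is its value.
    refine ⟨a * (y ^ 2 * β + γ), ?_⟩
    rw [mcoeff_one_mul, hgi, hgi1, mcoeff_sub, mcoeff_sub, mcoeff_sub, mcoeff_sub,
      mcoeff_zero_X_smul, mcoeff_one_X_smul]
    simp only [mcoeff_one_mul, mcoeff_zero_mul, hN, mcoeff_zero_map_C, mcoeff_one_map_C, hR0, hR1]
    split_ifs <;> ext i j <;> fin_cases i <;> fin_cases j <;> simp [nilp] <;> grind

theorem HasLead.of_first_order {m : ℕ} {g : SLSeries F} {T : Matrix (Fin 2) (Fin 2) F⟦X⟧}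
    (h : mat g = 1 + (X : F⟦X⟧) ^ m • T) (h0 : mcoeff 0 T = 0) :
    HasLead (m + 1) (mcoeff 1 T) g := by
  obtain ⟨W, hW, hW0⟩ := exists_eq_X_smul h0
  exact ⟨W, by rw [h, hW, smul_smul, pow_succ], hW0⟩

theorem smul_one_mem_leads [CharP F 2] {m : ℕ} (hm : 1 ≤ m) (h1 : FullLeads F 1)
    (h : FullLeads F m) (s : F) : s • (1 : Matrix (Fin 2) (Fin 2) F) ∈ leads F (m + 1) := by
  have key : s • (1 : Matrix (Fin 2) (Fin 2) F) =
      !![0, s; 0, -0] * !![0, 0; 1, -0] - !![0, 0; 1, -0] * !![0, s; 0, -0] := by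
    ext i j; fin_cases i <;> fin_cases j <;> simp [CharTwo.neg_eq]
  rw [key]
  exact leads_bracket hm le_rfl (h _ _ _) (h1 _ _ _)

/-- Modulo scalars, a multiple of `E₁₂` and a multiple of `E₂₁` that are leading terms
produce all traceless matrices in characteristic two. -/
theorem fullLeads_of_char_two [CharP F 2] {m : ℕ} (hm : 1 ≤ m)
    (hs : ∀ s : F, s • (1 : Matrix (Fin 2) (Fin 2) F) ∈ leads F m)
    (h : ∀ β γ : F, ∃ α : F, !![α, β; γ, -α] ∈ leads F m) : FullLeads F m := by
  intro α β γ
  obtain ⟨α', h'⟩ := h β γ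
  have key : !![α, β; γ, -α] = (α - α') • (1 : Matrix (Fin 2) (Fin 2) F) + !![α', β; γ, -α'] := by
    have two : (2 : F) = 0 := CharTwo.two_eq_zero
    ext i j; fin_cases i <;> fin_cases j <;> simp; grind
  rw [key]
  exact leads_add hm (hs _) h'

/-- The scalar leading term of the commutator depends only on the product of its two parameters. The
pairs (1, u) and (c, u/c) share that product, so in characteristic two the leading terms cancel, and
the second-order terms leave u(1 + c) N(y) plus scalars and a multiple of E₂₁. -/
theorem FullLeads.add_two [CharP F 2] {c : F} (hc0 : c ≠ 0) (hc1 : c ≠ 1) {m : ℕ} (hm : 1 ≤ m)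
    (h1 : FullLeads F 1) (h : FullLeads F m) (h' : FullLeads F (m + 1)) : FullLeads F (m + 2) := by
  have two : (2 : F) = 0 := CharTwo.two_eq_zero
  have hs : ∀ s : F, s • (1 : Matrix (Fin 2) (Fin 2) F) ∈ leads F (m + 2) :=
    smul_one_mem_leads (by omega) h1 h'
  have hc : 1 + c ≠ 0 := fun h0 => hc1 (by grind)
  -- It is essential that ρ does not depend on y: adding the cases y = 0 and y = 1 then removes it,
  -- and N(0) + N(1) = 1 + E₂₁ isolates E₂₁.
  have key : ∀ u : F, ∃ ρ : F, ∀ y : F,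
      u • nilp y + ρ • !![0, 0; 1, 0] ∈ leads F (m + 2) := by
    intro v
    obtain ⟨u, rfl⟩ : ∃ u, v = u * (1 + c) := ⟨v / (1 + c), (div_mul_cancel₀ _ hc).symm⟩
    obtain ⟨g₁, hg₁, hl₁⟩ := h 0 0 u
    obtain ⟨g₂, hg₂, hl₂⟩ := h 0 0 (u / c)
    rw [neg_zero] at hl₁ hl₂
    refine ⟨(if m = 1 then 1 * u ^ 2 else 0) + (if m = 1 then c * (u / c) ^ 2 else 0), fun y => ?_⟩
    obtain ⟨k₁, hk₁, T₁, hT₁, hc₁, s₁, hd₁⟩ := exists_commutator_second_order hm 1 y u hg₁ hl₁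
    obtain ⟨k₂, hk₂, T₂, hT₂, hc₂, s₂, hd₂⟩ := exists_commutator_second_order hm c y (u / c) hg₂ hl₂
    have hP : mat (k₁ * k₂) =
        1 + (X : F⟦X⟧) ^ (m + 1) • (T₁ + T₂ + (X : F⟦X⟧) ^ (m + 1) • (T₁ * T₂)) := by
      rw [mat_mul, hT₁, hT₂]
      simp only [mul_add, add_mul, one_mul, mul_one, smul_add, smul_mul_assoc, mul_smul_comm]
      abel
    have hP0 : mcoeff 0 (T₁ + T₂ + (X : F⟦X⟧) ^ (m + 1) • (T₁ * T₂)) = 0 := by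
      rw [mcoeff_add, mcoeff_add, mcoeff_X_pow_smul_of_lt (by omega), hc₁, hc₂, add_zero,
        mul_div_cancel₀ _ hc0, one_mul, ← add_smul, CharTwo.add_self_eq_zero, zero_smul]
    have hl := HasLead.of_first_order hP hP0
    rw [mcoeff_add, mcoeff_add, mcoeff_X_pow_smul_of_lt (by omega), hd₁, hd₂, add_zero] at hl
    have hmem := leads_add (by omega) ⟨_, mul_mem hk₁ hk₂, hl⟩ (hs (s₁ + s₂))
    have hz : (s₁ + s₂) + (s₁ + s₂) = 0 := CharTwo.add_self_eq_zero _
    have hu : 1 ^ 2 * u + c ^ 2 * (u / c) = u * (1 + c) := by field_simp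
    rw [← hu]
    convert hmem using 1
    rw [add_smul, add_smul]
    have hz' : s₁ • (1 : Matrix (Fin 2) (Fin 2) F) + s₂ • 1 + (s₁ + s₂) • 1 = 0 := by
      rw [← add_smul, ← add_smul, hz, zero_smul]
    rw [← sub_eq_zero, ← neg_eq_zero, ← hz']
    abel
  have hlow : ∀ γ : F, γ • !![0, 0; 1, 0] ∈ leads F (m + 2) := by
    intro γ
    obtain ⟨ρ, hρ⟩ := key γ
    have hmem := leads_add (by omega) (leads_add (by omega) (hρ 0) (hρ 1)) (hs γ)
    convert hmem using 1
    ext i j; fin_cases i <;> fin_cases j <;> simp [nilp] <;> grind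
  refine fullLeads_of_char_two (by omega) hs fun β γ => ⟨0, ?_⟩
  obtain ⟨ρ, hρ⟩ := key β
  have hmem := leads_add (by omega) (hρ 0) (hlow (γ + ρ))
  convert hmem using 1
  ext i j; fin_cases i <;> fin_cases j <;> simp [nilp] <;> grind

/-! ### Characteristic two: degree two by interpolation. -/

/-- The product of the generators `1 + a_i X N(y_i)` to second order in characteristic two. -/
theorem exists_prod_gen_second_order [CharP F 2] {ι : Type*} (a y : ι → F) (s : Finset ι) :
    ∃ g ∈ genGroup F, ∃ R, mat g = 1 + (X : F⟦X⟧) ^ 1 • R ∧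
      mcoeff 0 R = !![∑ i ∈ s, a i * y i, ∑ i ∈ s, a i; ∑ i ∈ s, a i * y i ^ 2, ∑ i ∈ s, a i * y i] ∧
      mcoeff 1 R 0 1 = (∑ i ∈ s, a i) * (∑ i ∈ s, a i * y i) + ∑ i ∈ s, a i ^ 2 * y i ∧
      mcoeff 1 R 1 0 = (∑ i ∈ s, a i * y i) * (∑ i ∈ s, a i * y i ^ 2)
        + ∑ i ∈ s, a i ^ 2 * y i ^ 3 := by
  classical
  have two : (2 : F) = 0 := CharTwo.two_eq_zero
  induction s using Finset.induction_on with
  | empty =>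
    refine ⟨1, one_mem _, 0, by simp [mat_one], ?_, by simp [mcoeff], by simp [mcoeff]⟩
    ext i j; fin_cases i <;> fin_cases j <;> simp [mcoeff]
  | insert k s hk ih =>
    obtain ⟨g, hg, R, hR, h0, h01, h10⟩ := ih
    refine ⟨gen (a k) (y k) * g, mul_mem (gen_mem _ _) hg,
      (a k • nilp (y k)).map C + R + (X : F⟦X⟧) • ((a k • nilp (y k)).map C * R), ?_, ?_, ?_, ?_⟩
    · rw [mat_mul, coe_gen, hR, pow_one]
      simp only [mul_add, add_mul, one_mul, mul_one, smul_add, smul_mul_assoc, mul_smul_comm]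
      abel
    · rw [mcoeff_add, mcoeff_add, mcoeff_zero_X_smul, mcoeff_zero_map_C, h0]
      simp only [Finset.sum_insert hk]
      ext i j; fin_cases i <;> fin_cases j <;> simp [nilp] <;> grind
    · rw [mcoeff_add, mcoeff_add, mcoeff_one_X_smul, mcoeff_one_map_C, mcoeff_zero_mul,
        mcoeff_zero_map_C, h0]
      simp only [Finset.sum_insert hk, Matrix.add_apply, h01]
      simp [nilp]; grind
    · rw [mcoeff_add, mcoeff_add, mcoeff_one_X_smul, mcoeff_one_map_C, mcoeff_zero_mul,
        mcoeff_zero_map_C, h0]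
      simp only [Finset.sum_insert hk, Matrix.add_apply, h10]
      simp [nilp]; grind

/-- Interpolation at distinct nodes: the power sums of degree less than `n` weighted by `a`
may be prescribed. -/
theorem exists_weighted_power_sums {n : ℕ} {s : Fin n → F} (hs : Function.Injective s)
    (t : Fin n → F) : ∃ a : Fin n → F, ∀ j : Fin n, ∑ i, a i * s i ^ (j : ℕ) = t j := by
  have hdet : IsUnit (vandermonde s).det := (det_vandermonde_ne_zero_iff.2 hs).isUnit
  refine ⟨t ᵥ* (vandermonde s)⁻¹, fun j => ?_⟩
  have h : (t ᵥ* (vandermonde s)⁻¹) ᵥ* vandermonde s = t := by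
    rw [vecMul_vecMul, nonsing_inv_mul _ hdet, vecMul_one]
  simpa [vecMul, dotProduct, vandermonde_apply] using congrFun h j

/-- With y_i = s_i², the first-order term vanishes once the weighted power sums of s of degrees 0,
2, 4 do. The off-diagonal second-order entries are then the squares of the power sums of degrees 1
and 3, by additivity of squaring. Prescribing degrees 0 to 4 independently takes five nodes; over
four elements s⁴ = s would force b = 0. -/
theorem fullLeads_two_of_char_two [Fintype F] [CharP F 2] (hq : 5 ≤ Fintype.card F)
    (h1 : FullLeads F 1) : FullLeads F 2 := by
  refine fullLeads_of_char_two (by omega) (smul_one_mem_leads le_rfl h1 h1) fun β γ => ?_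
  have hsq : ∀ x : F, ∃ r, x = r ^ 2 := fun x => by
    obtain ⟨r, hr⟩ := FiniteField.isSquare_of_char_two (ringChar.eq F 2) x
    exact ⟨r, by rw [hr, sq]⟩
  obtain ⟨b, rfl⟩ := hsq β
  obtain ⟨c, rfl⟩ := hsq γ
  obtain ⟨s⟩ : Nonempty (Fin 5 ↪ F) := Function.Embedding.nonempty_of_card_le (by simpa using hq)
  obtain ⟨a, ha⟩ := exists_weighted_power_sums s.injective ![0, b, 0, c, 0]
  obtain ⟨g, hg, R, hR, h0, h01, h10⟩ :=
    exists_prod_gen_second_order a (fun i => s i ^ 2) Finset.univ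
  have e0 : ∑ i, a i = 0 := by simpa using ha 0
  have e1 : ∑ i, a i * s i = b := by simpa using ha 1
  have e2 : ∑ i, a i * s i ^ 2 = 0 := by simpa using ha 2
  have e3 : ∑ i, a i * s i ^ 3 = c := by simpa using ha 3
  have e4 : ∑ i, a i * (s i ^ 2) ^ 2 = 0 := by simpa [← pow_mul] using ha 4
  have e5 : ∑ i, a i ^ 2 * s i ^ 2 = b ^ 2 := by
    rw [← e1, CharTwo.sum_sq]; simp only [mul_pow]
  have e6 : ∑ i, a i ^ 2 * (s i ^ 2) ^ 3 = c ^ 2 := by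
    rw [← e3, CharTwo.sum_sq]; simp only [mul_pow, ← pow_mul]
  simp only [e0, e2, e4, e5, e6, zero_mul, zero_add] at h0 h01 h10
  have h0' : mcoeff 0 R = 0 := by
    rw [h0]; ext i j; fin_cases i <;> fin_cases j <;> rfl
  obtain ⟨W, hW, hWR⟩ := exists_eq_X_smul h0'
  have htr : (mcoeff 1 R).trace = 0 := by
    rw [← hWR, trace_mcoeff, trace_eq_of_mat_eq (m := 2) (g := g) (by rw [hR, hW, smul_smul]; rfl)]
    simp
  obtain ⟨α, β', γ', hA⟩ := exists_eq_of_trace_eq_zero htr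
  rw [hA] at h01 h10
  refine ⟨α, g, hg, ?_⟩
  have hl := HasLead.of_first_order hR h0'
  rw [hA] at hl
  simp only [of_apply, cons_val', cons_val_zero, cons_val_one, cons_val_fin_one] at h01 h10
  rwa [h01, h10] at hl

/-- Every traceless matrix is a leading term of every positive order. -/
theorem fullLeads [Fintype F] (hq3 : 3 ≤ Fintype.card F) (hq4 : Fintype.card F ≠ 4) (m : ℕ)
    (hm : 1 ≤ m) : FullLeads F m := by
  classical
  obtain ⟨c, hc⟩ : ∃ c : F, c ∉ ({0, 1} : Finset F) := by
    by_contra! h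
    have h1 := Finset.card_le_card (fun x _ => h x : (Finset.univ : Finset F) ⊆ {0, 1})
    rw [Finset.card_univ] at h1
    have := h1.trans Finset.card_le_two
    omega
  simp only [Finset.mem_insert, Finset.mem_singleton, not_or] at hc
  have h1 : FullLeads F 1 := fullLeads_one hc.1 hc.2
  by_cases h2 : (2 : F) = 0
  · have : CharP F 2 := CharTwo.of_one_ne_zero_of_two_eq_zero one_ne_zero h2
    obtain ⟨n, -, hn⟩ := FiniteField.card F 2
    have hq : 5 ≤ Fintype.card F := by
      have : (n : ℕ) ≠ 1 := fun h => by rw [hn, h] at hq3; omega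
      have : (n : ℕ) ≠ 2 := fun h => by rw [hn, h] at hq4; omega
      have h3 : 3 ≤ (n : ℕ) := by have := n.pos; omega
      have := Nat.pow_le_pow_right (n := 2) (by omega) h3
      omega
    have h12 := fullLeads_two_of_char_two hq h1
    induction m using Nat.strong_induction_on with
    | _ m ih =>
      match m, hm with
      | 1, _ => exact h1
      | 2, _ => exact h12
      | m + 3, _ =>
        exact FullLeads.add_two hc.1 hc.2 (by omega) h1 (ih (m + 1) (by omega) (by omega))
          (ih (m + 2) (by omega) (by omega))
  · induction m, hm using Nat.le_induction with
    | base => exact h1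
    | succ n hn ih => exact FullLeads.succ_of_two_ne_zero h2 h1 hn ih

/-! ### Points as matrices, and walks of length two as multiplication by generators. -/

variable {k : ℕ}

theorem gen_inv (a y : F) : (gen a y)⁻¹ = gen (-a) y := by
  refine inv_eq_of_mul_eq_one_right (Subtype.ext ?_)
  change mat (gen a y) * mat (gen (-a) y) = 1
  ext1 i j
  fin_cases i <;> fin_cases j <;> simp [mat, gen, Matrix.mul_apply] <;> ring

/-- The vector `(f 1, …, f k)`. -/
def vec {α : Type*} (k : ℕ) (f : ℕ → α) : Fin k → α := fun i => f (i + 1)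

theorem coord_vec (f : ℕ → F) {i : ℕ} (h1 : 1 ≤ i) (hk : i ≤ k) : coord (vec k f) i = f i := by
  simp [coord, vec, h1, hk]

theorem vec_coord (p : Fin k → F) : vec k (coord p) = p := by
  ext i; simp [coord, vec]

theorem vec_congr {α : Type*} {f g : ℕ → α} (h : ∀ i, 1 ≤ i → i ≤ k → f i = g i) : vec k f = vec k g := by
  ext i; exact h _ (by omega) (by omega)

theorem incident_vec {f g : ℕ → F} (h2 : f 2 + g 2 = f 1 * g 1) (h3 : f 3 + g 3 = f 1 * g 2)
    (h4 : ∀ j, f (4 * j + 4) + g (4 * j + 4) = f (4 * j + 2) * g 1)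
    (h5 : ∀ j, f (4 * j + 5) + g (4 * j + 5) = f (4 * j + 3) * g 1)
    (h6 : ∀ j, f (4 * j + 6) + g (4 * j + 6) = f 1 * g (4 * j + 4))
    (h7 : ∀ j, f (4 * j + 7) + g (4 * j + 7) = f 1 * g (4 * j + 5)) :
    Incident (vec k f) (vec k g) := by
  intro i hi hik
  rw [coord_vec f (by omega) hik, coord_vec g (by omega) hik, rhs]
  rw [coord_vec f le_rfl (by omega), coord_vec g le_rfl (by omega)]
  rcases (by omega : i = 2 ∨ i = 3 ∨ 4 ≤ i) with rfl | rfl | h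
  · simpa using h2
  · rw [coord_vec g (by omega) (by omega)]
    simpa using h3
  · rw [coord_vec f (by omega) (by omega), if_neg (by omega), if_neg (by omega)]
    obtain ⟨j, hj⟩ : ∃ j, i = 4 * j + 4 ∨ i = 4 * j + 5 ∨ i = 4 * j + 6 ∨ i = 4 * j + 7 :=
      ⟨i / 4 - 1, by omega⟩
    rcases hj with rfl | rfl | rfl | rfl
    · rw [if_pos (by omega)]; exact h4 j
    · rw [if_pos (by omega)]; exact h5 j
    · rw [if_neg (by omega), coord_vec g (by omega) (by omega)]; exact h6 j
    · rw [if_neg (by omega), coord_vec g (by omega) (by omega)]; exact h7 j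

/-- The coordinates of the point encoded by a matrix of power series. -/
noncomputable def pointCoord (M : Matrix (Fin 2) (Fin 2) F⟦X⟧) (i : ℕ) : F :=
  if i = 1 then -coeff 1 (M 0 1)
  else if i % 4 = 0 then coeff (i / 4) (M 1 0)
  else if i % 4 = 1 then -coeff ((i + 3) / 4) (M 1 1)
  else if i % 4 = 2 then coeff ((i + 2) / 4) (M 0 0)
  else -coeff ((i + 5) / 4) (M 0 1)

section pointCoord

variable (M : Matrix (Fin 2) (Fin 2) F⟦X⟧) (j : ℕ)

theorem pointCoord_one : pointCoord M 1 = -coeff 1 (M 0 1) := rfl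

theorem pointCoord_add_two : pointCoord M (4 * j + 2) = coeff (j + 1) (M 0 0) := by
  rw [pointCoord, if_neg (by omega), if_neg (by omega), if_neg (by omega), if_pos (by omega)]
  congr 2; omega

theorem pointCoord_add_three : pointCoord M (4 * j + 3) = -coeff (j + 2) (M 0 1) := by
  rw [pointCoord, if_neg (by omega), if_neg (by omega), if_neg (by omega), if_neg (by omega)]
  congr 3; omega

theorem pointCoord_add_four : pointCoord M (4 * j + 4) = coeff (j + 1) (M 1 0) := by
  rw [pointCoord, if_neg (by omega), if_pos (by omega)]
  congr 2; omega

theorem pointCoord_add_five : pointCoord M (4 * j + 5) = -coeff (j + 2) (M 1 1) := by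
  rw [pointCoord, if_neg (by omega), if_neg (by omega), if_pos (by omega)]
  congr 3; omega

end pointCoord

/-- The coordinates of the neighbour with first coordinate `y` of the point with
coordinates `f`. -/
def lineCoord (f : ℕ → F) (y : F) (i : ℕ) : F :=
  if i = 1 then y
  else if i = 2 then f 1 * y - f 2
  else if i = 3 then f 1 * (f 1 * y - f 2) - f 3
  else if i % 4 = 0 ∨ i % 4 = 1 then f (i - 2) * y - f i
  else f 1 * (f (i - 4) * y - f (i - 2)) - f i

section lineCoord

variable (f : ℕ → F) (y : F) (j : ℕ)

theorem lineCoord_add_four : lineCoord f y (4 * j + 4) = f (4 * j + 2) * y - f (4 * j + 4) := by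
  rw [lineCoord, if_neg (by omega), if_neg (by omega), if_neg (by omega), if_pos (by omega)]; rfl

theorem lineCoord_add_five : lineCoord f y (4 * j + 5) = f (4 * j + 3) * y - f (4 * j + 5) := by
  rw [lineCoord, if_neg (by omega), if_neg (by omega), if_neg (by omega), if_pos (by omega)]; rfl

theorem lineCoord_add_six : lineCoord f y (4 * j + 6) =
    f 1 * (f (4 * j + 2) * y - f (4 * j + 4)) - f (4 * j + 6) := by
  rw [lineCoord, if_neg (by omega), if_neg (by omega), if_neg (by omega), if_neg (by omega)]; rfl

theorem lineCoord_add_seven : lineCoord f y (4 * j + 7) =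
    f 1 * (f (4 * j + 3) * y - f (4 * j + 5)) - f (4 * j + 7) := by
  rw [lineCoord, if_neg (by omega), if_neg (by omega), if_neg (by omega), if_neg (by omega)]; rfl

end lineCoord

theorem incident_lineCoord (f : ℕ → F) (y : F) : Incident (vec k f) (vec k (lineCoord f y)) := by
  refine incident_vec ?_ ?_ (fun j => ?_) (fun j => ?_) (fun j => ?_) (fun j => ?_)
  · simp [lineCoord]
  · simp [lineCoord]
  · rw [lineCoord_add_four]; simp [lineCoord]
  · rw [lineCoord_add_five]; simp [lineCoord]
  · rw [lineCoord_add_four, lineCoord_add_six]; ring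
  · rw [lineCoord_add_five, lineCoord_add_seven]; ring

/-- With w = (y, -1)g, the upper row gains a X w and the lower row a y X w, so w itself does not
change. Up to sign, its coefficients are the coordinates l_i, i ≥ 4 and i ≡ 0, 1 mod 4, of the
common neighbouring line. -/
theorem mat_gen_mul_zero (a y : F) (g : SLSeries F) (j : Fin 2) :
    mat (gen a y * g) 0 j = mat g 0 j + X * (C a * (C y * mat g 0 j - mat g 1 j)) := by
  rw [mat_mul, Matrix.mul_apply, Fin.sum_univ_two]
  simp [mat, gen]; ring

theorem mat_gen_mul_one (a y : F) (g : SLSeries F) (j : Fin 2) :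
    mat (gen a y * g) 1 j = mat g 1 j + X * (C (a * y) * (C y * mat g 0 j - mat g 1 j)) := by
  rw [mat_mul, Matrix.mul_apply, Fin.sum_univ_two]
  simp [mat, gen]; ring

theorem coeff_mat_gen_mul_zero (a y : F) (g : SLSeries F) (j : Fin 2) (n : ℕ) :
    coeff (n + 1) (mat (gen a y * g) 0 j) = coeff (n + 1) (mat g 0 j) +
      a * (y * coeff n (mat g 0 j) - coeff n (mat g 1 j)) := by
  simp [mat_gen_mul_zero]

theorem coeff_mat_gen_mul_one (a y : F) (g : SLSeries F) (j : Fin 2) (n : ℕ) :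
    coeff (n + 1) (mat (gen a y * g) 1 j) = coeff (n + 1) (mat g 1 j) +
      a * y * (y * coeff n (mat g 0 j) - coeff n (mat g 1 j)) := by
  simp [mat_gen_mul_one, mul_assoc]

/-- The points encoded by `g` and by `(1 + a X N(y)) g` have a common neighbour. -/
theorem incident_gen_mul (a y : F) {g : SLSeries F} (h0 : mcoeff 0 (mat g) = 1)
    (h1 : (mcoeff 1 (mat g)).trace = 0) :
    Incident (vec k (pointCoord (mat (gen a y * g))))
      (vec k (lineCoord (pointCoord (mat g)) y)) := by
  have e : ∀ i j, coeff 0 (mat g i j) = (1 : Matrix (Fin 2) (Fin 2) F) i j := fun i j => by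
    rw [← h0]; rfl
  have h1' : coeff 1 (mat g 0 0) + coeff 1 (mat g 1 1) = 0 := by
    simpa [trace_fin_two, mcoeff] using h1
  have c0 := coeff_mat_gen_mul_zero a y g
  have c1 := coeff_mat_gen_mul_one a y g
  have q1 : pointCoord (mat (gen a y * g)) 1 = pointCoord (mat g) 1 + a := by
    rw [pointCoord_one, pointCoord_one, c0 1 0, e, e]; simp [add_comm]
  have p2 := pointCoord_add_two (mat g) 0
  have q2 : pointCoord (mat (gen a y * g)) 2 = pointCoord (mat g) 2 + a * y := by
    have := pointCoord_add_two (mat (gen a y * g)) 0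
    rw [c0 0 0, e, e] at this
    simp at this p2
    rw [this, p2]
  refine incident_vec ?_ ?_ (fun j => ?_) (fun j => ?_) (fun j => ?_) (fun j => ?_)
  · rw [q1, q2]; simp only [lineCoord]; norm_num; ring
  · have p3 := pointCoord_add_three (mat g) 0
    have q3 := pointCoord_add_three (mat (gen a y * g)) 0
    rw [c0 1 1] at q3
    rw [q1]
    have p1 := pointCoord_one (mat g)
    simp at p2 p3 q3
    rw [q3]; simp only [lineCoord]; norm_num
    rw [p3, p2, p1]
    -- The coefficient D_1 is not a coordinate of the point; the trace condition identifies it with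
    -- -p_2.
    linear_combination a * h1'
  · rw [lineCoord_add_four, pointCoord_add_four, pointCoord_add_four, pointCoord_add_two,
      pointCoord_add_two, c1, c0]
    simp only [lineCoord]; norm_num; ring
  · rw [lineCoord_add_five, pointCoord_add_five, pointCoord_add_five, pointCoord_add_three,
      pointCoord_add_three, c1, c0]
    simp only [lineCoord]; norm_num; ring
  · rw [lineCoord_add_four, lineCoord_add_six, q1, show 4 * j + 6 = 4 * (j + 1) + 2 by ring]
    simp only [pointCoord_add_four, pointCoord_add_two, c0]; ring
  · rw [lineCoord_add_five, lineCoord_add_seven, q1, show 4 * j + 7 = 4 * (j + 1) + 3 by ring]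
    simp only [pointCoord_add_five, pointCoord_add_three, c0, show j + 1 + 2 = j + 2 + 1 by ring]
    ring

theorem reachable_gen_mul (a y : F) {g : SLSeries F} (h0 : mcoeff 0 (mat g) = 1)
    (h1 : (mcoeff 1 (mat g)).trace = 0) :
    (graph F k).Reachable (Vertex.point (vec k (pointCoord (mat g))))
      (Vertex.point (vec k (pointCoord (mat (gen a y * g))))) := by
  have hadj : (graph F k).Adj (Vertex.point (vec k (pointCoord (mat g))))
      (Vertex.line (vec k (lineCoord (pointCoord (mat g)) y))) := incident_lineCoord _ _
  have hadj' : (graph F k).Adj (Vertex.line (vec k (lineCoord (pointCoord (mat g)) y)))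
      (Vertex.point (vec k (pointCoord (mat (gen a y * g))))) := incident_gen_mul a y h0 h1
  exact hadj.reachable.trans hadj'.reachable

theorem mcoeff_zero_gen_mul (a y : F) {g : SLSeries F} (h0 : mcoeff 0 (mat g) = 1) :
    mcoeff 0 (mat (gen a y * g)) = 1 := by
  rw [mat_mul, mcoeff_zero_mul, h0, mul_one, (hasLead_gen a y).mcoeff_zero le_rfl]

theorem trace_mcoeff_one {g : SLSeries F} (h0 : mcoeff 0 (mat g) = 1) :
    (mcoeff 1 (mat g)).trace = 0 := by
  have h : mcoeff 0 (mat g - 1) = 0 := by rw [mcoeff_sub, mcoeff_zero_one, h0, sub_self]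
  obtain ⟨W, hW, -⟩ := exists_eq_X_smul h
  have hg : mat g = 1 + (X : F⟦X⟧) ^ 1 • W := by rw [pow_one, ← hW, add_sub_cancel]
  rw [hg, mcoeff_add, mcoeff_one_one, zero_add, pow_one, mcoeff_one_X_smul, trace_mcoeff,
    trace_eq_of_mat_eq hg]
  simp

/-- All points encoded by elements of the generated group lie in the component of the point
zero. -/
theorem reachable_of_mem_genGroup {g : SLSeries F} (hg : g ∈ genGroup F) :
    mcoeff 0 (mat g) = 1 ∧
      (graph F k).Reachable (Vertex.point 0) (Vertex.point (vec k (pointCoord (mat g)))) := by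
  have step : ∀ (a y : F) (g : SLSeries F), (mcoeff 0 (mat g) = 1 ∧
      (graph F k).Reachable (Vertex.point 0) (Vertex.point (vec k (pointCoord (mat g))))) →
      mcoeff 0 (mat (gen a y * g)) = 1 ∧ (graph F k).Reachable (Vertex.point 0)
        (Vertex.point (vec k (pointCoord (mat (gen a y * g))))) := fun a y g h =>
    ⟨mcoeff_zero_gen_mul a y h.1,
      h.2.trans (reachable_gen_mul a y h.1 (trace_mcoeff_one h.1))⟩
  induction hg using Subgroup.closure_induction_left with
  | one =>
    refine ⟨mcoeff_zero_one, ?_⟩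
    have : vec k (pointCoord (mat (1 : SLSeries F))) = 0 := by
      ext i
      simp only [vec, pointCoord, mat_one, Pi.zero_apply]
      (split_ifs <;> simp [PowerSeries.coeff_one]); omega
    rw [this]
  | mul_left x hx g _ ih =>
    obtain ⟨⟨a, y⟩, rfl⟩ := hx
    exact step a y g ih
  | inv_mul_cancel x hx g _ ih =>
    obtain ⟨⟨a, y⟩, rfl⟩ := hx
    simp only [gen_inv]
    exact step (-a) y g ih

/-! ### The determinant and the point invariants. -/

/-- The upper left entry of the matrix attached to a sequence of coordinates. -/
noncomputable def seriesA (f : ℕ → F) : F⟦X⟧ :=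
  PowerSeries.mk fun j => if j = 0 then 1 else f (4 * j - 2)

/-- The upper right entry of the matrix attached to a sequence of coordinates. -/
noncomputable def seriesB (f : ℕ → F) : F⟦X⟧ :=
  PowerSeries.mk fun j => if j = 0 then 0 else if j = 1 then -f 1 else -f (4 * j - 5)

/-- The lower left entry of the matrix attached to a sequence of coordinates. -/
noncomputable def seriesC (f : ℕ → F) : F⟦X⟧ :=
  PowerSeries.mk fun j => if j = 0 then 0 else f (4 * j)

/-- The lower right entry of the matrix attached to a sequence of coordinates. -/
noncomputable def seriesD (f : ℕ → F) : F⟦X⟧ :=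
  PowerSeries.mk fun j => if j = 0 then 1 else if j = 1 then -f 2 else -f (4 * j - 3)

/-- The invariants of a point in terms of a sequence of coordinates, up to sign. -/
def seqInvariant (f : ℕ → F) (r : ℕ) : F :=
  f 1 * f (4 * r - 4) - f 2 * f (4 * r - 6) - f 2 * f (4 * r - 7) + f 3 * f (4 * r - 8)
    - f (4 * r - 3) + f (4 * r - 2)
    + ∑ i ∈ Finset.Icc 2 (r - 2),
        (-(f (4 * i - 3) * f (4 * (r - i) - 2)) + f (4 * i - 1) * f (4 * (r - i) - 4))

theorem sum_Icc_two_eq_sum_range (n : ℕ) (u : ℕ → F) :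
    ∑ i ∈ Finset.Icc 2 (n + 1), u i = ∑ i ∈ Finset.range n, u (i + 2) := by
  rw [← Finset.Ico_add_one_right_eq_Icc, Finset.sum_Ico_eq_sum_range]
  exact Finset.sum_congr rfl fun i _ => by rw [add_comm]

theorem seqInvariant_add_three (f : ℕ → F) (n : ℕ) : seqInvariant f (n + 3) =
    f 1 * f (4 * n + 8) - f 2 * f (4 * n + 6) - f 2 * f (4 * n + 5) + f 3 * f (4 * n + 4)
      - f (4 * n + 9) + f (4 * n + 10)
      + ∑ i ∈ Finset.range n,
        (-(f (4 * i + 5) * f (4 * (n + 1 - i) - 2)) + f (4 * i + 7) * f (4 * (n + 1 - i) - 4)) := by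
  rw [seqInvariant, show n + 3 - 2 = n + 1 by omega, sum_Icc_two_eq_sum_range]
  congr 1
  refine Finset.sum_congr rfl fun i _ => ?_
  rw [show n + 3 - (i + 2) = n + 1 - i by omega]
  rfl

/-- The products that involve coefficients of index 0 or 1 of the series, together with the last
nonzero product of B and C, give the explicit terms; the remaining products form the sum in the
invariant. -/
theorem coeff_det_series (f : ℕ → F) (n : ℕ) :
    coeff (n + 3) (seriesD f * seriesA f - seriesB f * seriesC f) = seqInvariant f (n + 3) := by
  rw [map_sub, PowerSeries.coeff_mul, PowerSeries.coeff_mul,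
    Finset.Nat.sum_antidiagonal_eq_sum_range_succ_mk,
    Finset.Nat.sum_antidiagonal_eq_sum_range_succ_mk]
  have hD : ∑ i ∈ Finset.range (n + 3).succ,
      coeff i (seriesD f) * coeff (n + 3 - i) (seriesA f) =
      f (4 * n + 10) - f 2 * f (4 * n + 6)
        - ∑ i ∈ Finset.range n, f (4 * i + 5) * f (4 * (n + 1 - i) - 2)
        - f (4 * n + 5) * f 2 - f (4 * n + 9) := by
    rw [Finset.sum_range_succ, Finset.sum_range_succ, Finset.sum_range_succ',
      Finset.sum_range_succ']
    have hs : ∑ i ∈ Finset.range n, coeff (i + 1 + 1) (seriesD f) *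
        coeff (n + 3 - (i + 1 + 1)) (seriesA f) =
        -∑ i ∈ Finset.range n, f (4 * i + 5) * f (4 * (n + 1 - i) - 2) := by
      rw [← Finset.sum_neg_distrib]
      refine Finset.sum_congr rfl fun i hi => ?_
      rw [Finset.mem_range] at hi
      rw [show n + 3 - (i + 1 + 1) = n + 1 - i by omega]
      simp only [seriesD, seriesA, coeff_mk]
      rw [if_neg (by omega), if_neg (by omega), if_neg (by omega), neg_mul]
      rfl
    rw [hs]
    simp only [seriesD, seriesA, coeff_mk]
    simp [show n + 3 - (n + 2) = 1 by omega, show 4 * (n + 3) - 2 = 4 * n + 10 by omega,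
      show 4 * (n + 2) - 2 = 4 * n + 6 by omega, show 4 * (n + 3) - 3 = 4 * n + 9 by omega,
      show 4 * (n + 2) - 3 = 4 * n + 5 by omega]
    ring
  have hB : ∑ i ∈ Finset.range (n + 3).succ,
      coeff i (seriesB f) * coeff (n + 3 - i) (seriesC f) =
      -(f 1 * f (4 * n + 8)) - f 3 * f (4 * n + 4)
        - ∑ i ∈ Finset.range n, f (4 * i + 7) * f (4 * (n + 1 - i) - 4) := by
    rw [Finset.sum_range_succ, Finset.sum_range_succ', Finset.sum_range_succ',
      Finset.sum_range_succ']
    have hs : ∑ i ∈ Finset.range n, coeff (i + 1 + 1 + 1) (seriesB f) *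
        coeff (n + 3 - (i + 1 + 1 + 1)) (seriesC f) =
        -∑ i ∈ Finset.range n, f (4 * i + 7) * f (4 * (n + 1 - i) - 4) := by
      rw [← Finset.sum_neg_distrib]
      refine Finset.sum_congr rfl fun i hi => ?_
      rw [Finset.mem_range] at hi
      rw [show n + 3 - (i + 1 + 1 + 1) = n - i by omega,
        show 4 * (n + 1 - i) - 4 = 4 * (n - i) by omega]
      simp only [seriesB, seriesC, coeff_mk]
      rw [if_neg (by omega), if_neg (by omega), if_neg (by omega), neg_mul]
      rfl
    rw [hs]
    simp only [seriesB, seriesC, coeff_mk]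
    simp [show 4 * (n + 2) = 4 * n + 8 by omega, show 4 * (n + 1) = 4 * n + 4 by omega]
    ring
  rw [hD, hB, seqInvariant_add_three, Finset.sum_add_distrib, Finset.sum_neg_distrib]
  ring

theorem coeff_two_det_series (f : ℕ → F) :
    coeff 2 (seriesD f * seriesA f - seriesB f * seriesC f) =
      -(-(f 1 * f 4) + f 2 ^ 2 + f 5 - f 6) := by
  rw [map_sub, PowerSeries.coeff_mul, PowerSeries.coeff_mul,
    Finset.Nat.sum_antidiagonal_eq_sum_range_succ_mk,
    Finset.Nat.sum_antidiagonal_eq_sum_range_succ_mk]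
  simp [Finset.sum_range_succ, seriesA, seriesB, seriesC, seriesD]
  ring

/-- Built into the encoding: D_1 = -p_2 = -A_1. Hence the invariants start at r = 2. -/
theorem coeff_one_det_series (f : ℕ → F) :
    coeff 1 (seriesD f * seriesA f - seriesB f * seriesC f) = 0 := by
  rw [map_sub, coeff_one_mul', coeff_one_mul']
  simp [seriesA, seriesB, seriesC, seriesD]

theorem coeff_zero_det_series (f : ℕ → F) :
    coeff 0 (seriesD f * seriesA f - seriesB f * seriesC f) = 1 := by
  simp only [map_sub, PowerSeries.coeff_mul, Finset.Nat.antidiagonal_zero, Finset.sum_singleton,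
    seriesA, seriesB, seriesC, seriesD, coeff_mk]
  simp

theorem pointInvariant_two (p : Fin k → F) : pointInvariant p 2 =
    -(coord p 1 * coord p 4) + coord p 2 ^ 2 + coord p 5 - coord p 6 := rfl

theorem pointInvariant_add_three (p : Fin k → F) (n : ℕ) :
    pointInvariant p (n + 3) = (-1) ^ (n + 2) * seqInvariant (coord p) (n + 3) := by
  rw [pointInvariant, if_neg (by omega)]; rfl

/-- A point whose invariants vanish is encoded by an element of the congruence subgroup. -/
theorem exists_mat_of_pointInvariant (p : Fin k → F)
    (hp : ∀ r, 2 ≤ r → r ≤ tNum k → pointInvariant p r = 0) :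
    ∃ g : SLSeries F, mcoeff 0 (mat g) = 1 ∧ vec k (pointCoord (mat g)) = p := by
  set f := coord p with hf
  have hd : constantCoeff (seriesD f) ≠ 0 := by
    simp [seriesD, ← PowerSeries.coeff_zero_eq_constantCoeff_apply]
  have hdd := PowerSeries.mul_inv_cancel _ hd
  -- Solving det = 1 for the upper left entry makes the determinant exactly one. Vanishing
  -- invariants say that this entry agrees with A through degree t, and A_m = p_{4m-2} is a genuine
  -- coordinate only if 4m - 2 ≤ k, that is m ≤ t, so no coordinate changes.
  set a := (1 + seriesB f * seriesC f) * (seriesD f)⁻¹ with ha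
  have hdet : a * seriesD f - seriesB f * seriesC f = 1 := by
    rw [ha]; linear_combination (1 + seriesB f * seriesC f) * hdd
  have hcong : (X : F⟦X⟧) ^ (tNum k + 1) ∣ seriesA f - a := by
    have h1 : (X : F⟦X⟧) ^ (tNum k + 1) ∣ seriesD f * seriesA f - seriesB f * seriesC f - 1 := by
      rw [PowerSeries.X_pow_dvd_iff]
      intro m hm
      rw [map_sub, sub_eq_zero]
      match m with
      | 0 => rw [coeff_zero_det_series]; simp
      | 1 => rw [coeff_one_det_series]; simp [PowerSeries.coeff_one]
      | 2 =>
        rw [coeff_two_det_series, ← pointInvariant_two, hp 2 le_rfl (by omega)]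
        simp [PowerSeries.coeff_one]
      | n + 3 =>
        have h := hp (n + 3) (by omega) (by omega)
        rw [pointInvariant_add_three] at h
        rw [coeff_det_series, (mul_eq_zero.1 h).resolve_left (pow_ne_zero _ (by simp))]
        simp [PowerSeries.coeff_one]
    have h2 : seriesA f - a =
        (seriesD f * seriesA f - seriesB f * seriesC f - 1) * (seriesD f)⁻¹ := by
      rw [ha]; linear_combination -seriesA f * hdd
    rw [h2]
    exact h1.mul_right _
  have hcoeff : ∀ m, m ≤ tNum k → coeff m a = coeff m (seriesA f) := fun m hm => by
    have := PowerSeries.X_pow_dvd_iff.1 hcong m (by omega)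
    rw [map_sub, sub_eq_zero] at this
    exact this.symm
  refine ⟨⟨!![a, seriesB f; seriesC f, seriesD f], by rw [det_fin_two_of, hdet]⟩, ?_, ?_⟩
  · have h0 := hcoeff 0 (by omega)
    ext i j
    fin_cases i <;> fin_cases j <;>
      simp [mcoeff, mat, ← PowerSeries.coeff_zero_eq_constantCoeff_apply, h0, seriesA, seriesB,
        seriesC, seriesD]
  · rw [← vec_coord p, ← hf]
    refine vec_congr fun i h1 hik => ?_
    rcases (by omega : i = 1 ∨ i = 2 ∨ i = 3 ∨ 4 ≤ i) with rfl | rfl | rfl | h4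
    · simp [pointCoord, mat, seriesB]
    · have := hcoeff 1 (by unfold tNum; omega)
      simp [pointCoord, mat, this, seriesA]
    · simp [pointCoord, mat, seriesB]
    obtain ⟨j, hj⟩ : ∃ j, i = 4 * j + 4 ∨ i = 4 * j + 5 ∨ i = 4 * j + 6 ∨ i = 4 * j + 7 :=
      ⟨i / 4 - 1, by omega⟩
    rcases hj with rfl | rfl | rfl | rfl
    · rw [pointCoord_add_four]
      simp [mat, seriesC, mul_add]
    · rw [pointCoord_add_five]
      simp [mat, seriesD, show 4 * (j + 2) - 3 = 4 * j + 5 by omega]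
    · have := hcoeff (j + 2) (by unfold tNum; omega)
      rw [show 4 * j + 6 = 4 * (j + 1) + 2 by ring, pointCoord_add_two]
      simp [mat, this, seriesA, show 4 * (j + 2) - 2 = 4 * (j + 1) + 2 by omega]
    · rw [show 4 * j + 7 = 4 * (j + 1) + 3 by ring, pointCoord_add_three]
      simp [mat, seriesB, show 4 * (j + 1 + 2) - 5 = 4 * (j + 1) + 3 by omega]

/-- The i-th coordinate reads a coefficient of degree at most i, so precision X^(k+1) suffices. -/
theorem vec_pointCoord_congr (hk : 2 ≤ k) {M N R : Matrix (Fin 2) (Fin 2) F⟦X⟧}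
    (h : M = N + (X : F⟦X⟧) ^ (k + 1) • R) : vec k (pointCoord M) = vec k (pointCoord N) := by
  have hc : ∀ n i j, n ≤ k → coeff n (M i j) = coeff n (N i j) := fun n i j hn => by
    rw [h]
    simp [PowerSeries.coeff_X_pow_mul', show ¬k + 1 ≤ n by omega]
  refine vec_congr fun i h1 hik => ?_
  simp only [pointCoord]
  split_ifs <;> rw [hc _ _ _ (by omega)]

theorem reachable_point [Fintype F] (hq3 : 3 ≤ Fintype.card F) (hq4 : Fintype.card F ≠ 4)
    (hk : 2 ≤ k) (p : Fin k → F)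
    (hp : ∀ r, 2 ≤ r → r ≤ tNum k → pointInvariant p r = 0) :
    (graph F k).Reachable (Vertex.point 0) (Vertex.point p) := by
  obtain ⟨g, hg, rfl⟩ := exists_mat_of_pointInvariant p hp
  obtain ⟨h, hh, R, hR⟩ := exists_mem_genGroup_approx (fullLeads hq3 hq4) g hg k
  rw [vec_pointCoord_congr hk hR]
  exact (reachable_of_mem_genGroup hh).2

/-! ### Reduction from lines to points. -/

/-- The coordinates of the neighbour with first coordinate zero of the line with
coordinates `l`. -/
def footCoord (l : ℕ → F) (i : ℕ) : F :=
  if i = 1 then 0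
  else if 4 ≤ i ∧ (i % 4 = 0 ∨ i % 4 = 1) then -(l (i - 2) * l 1) - l i
  else -l i

section footCoord

variable (l : ℕ → F) (j : ℕ)

theorem footCoord_one : footCoord l 1 = 0 := rfl

theorem footCoord_add_two : footCoord l (4 * j + 2) = -l (4 * j + 2) := by
  rw [footCoord, if_neg (by omega), if_neg (by omega)]

theorem footCoord_add_three : footCoord l (4 * j + 3) = -l (4 * j + 3) := by
  rw [footCoord, if_neg (by omega), if_neg (by omega)]

theorem footCoord_add_four :
    footCoord l (4 * j + 4) = -(l (4 * j + 2) * l 1) - l (4 * j + 4) := by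
  rw [footCoord, if_neg (by omega), if_pos (by omega)]; rfl

theorem footCoord_add_five :
    footCoord l (4 * j + 5) = -(l (4 * j + 3) * l 1) - l (4 * j + 5) := by
  rw [footCoord, if_neg (by omega), if_pos (by omega)]; rfl

end footCoord

theorem incident_footCoord (l : ℕ → F) : Incident (vec k (footCoord l)) (vec k l) := by
  refine incident_vec ?_ ?_ (fun j => ?_) (fun j => ?_) (fun j => ?_) (fun j => ?_)
  · simp [footCoord]
  · simp [footCoord]
  · rw [footCoord_add_four, footCoord_add_two]; ring
  · rw [footCoord_add_five, footCoord_add_three]; ring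
  · rw [show 4 * j + 6 = 4 * (j + 1) + 2 by ring, footCoord_add_two, footCoord_one]; ring
  · rw [show 4 * j + 7 = 4 * (j + 1) + 3 by ring, footCoord_add_three, footCoord_one]; ring

/-- The invariants of a line in terms of a sequence of coordinates, up to sign. -/
def seqLineInvariant (l : ℕ → F) (r : ℕ) : F :=
  l 1 * l (4 * r - 5) - l 2 * l (4 * r - 6) - l 2 * l (4 * r - 7) + l 3 * l (4 * r - 8)
    + l (4 * r - 3) - l (4 * r - 2)
    + ∑ i ∈ Finset.Icc 2 (r - 2),
        (-(l (4 * i - 3) * l (4 * (r - i) - 2)) + l (4 * i - 1) * l (4 * (r - i) - 4))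

theorem seqLineInvariant_add_three (l : ℕ → F) (n : ℕ) : seqLineInvariant l (n + 3) =
    l 1 * l (4 * n + 7) - l 2 * l (4 * n + 6) - l 2 * l (4 * n + 5) + l 3 * l (4 * n + 4)
      + l (4 * n + 9) - l (4 * n + 10)
      + ∑ i ∈ Finset.range n,
        (-(l (4 * i + 5) * l (4 * (n + 1 - i) - 2)) + l (4 * i + 7) * l (4 * (n + 1 - i) - 4)) := by
  rw [seqLineInvariant, show n + 3 - 2 = n + 1 by omega, sum_Icc_two_eq_sum_range]
  congr 1
  refine Finset.sum_congr rfl fun i _ => ?_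
  rw [show n + 3 - (i + 2) = n + 1 - i by omega]
  rfl

/-- The extra terms with factor l_1 inside the sum telescope, and the two ends cancel the cubic
terms of f_2 f_{4n+5} and f_3 f_{4n+4}, where f is the foot. The term l_1 l_{4n+7} of the line
invariant comes from f_{4n+9}, since f_1 = 0 kills the first product. -/
theorem seqInvariant_footCoord (l : ℕ → F) (n : ℕ) :
    seqInvariant (footCoord l) (n + 3) = seqLineInvariant l (n + 3) := by
  rw [seqInvariant_add_three, seqLineInvariant_add_three]
  have hs : ∑ i ∈ Finset.range n,
      (-(footCoord l (4 * i + 5) * footCoord l (4 * (n + 1 - i) - 2))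
        + footCoord l (4 * i + 7) * footCoord l (4 * (n + 1 - i) - 4)) =
      ∑ i ∈ Finset.range n,
        (-(l (4 * i + 5) * l (4 * (n + 1 - i) - 2)) + l (4 * i + 7) * l (4 * (n + 1 - i) - 4)) +
      l 1 * (l (4 * n + 3) * l 2 - l 3 * l (4 * n + 2)) := by
    have ht : ∑ i ∈ Finset.range n, (l (4 * (i + 1) + 3) * l (4 * (n - (i + 1)) + 2)
        - l (4 * i + 3) * l (4 * (n - i) + 2)) = l (4 * n + 3) * l 2 - l 3 * l (4 * n + 2) := by
      rw [Finset.sum_range_sub (fun i => l (4 * i + 3) * l (4 * (n - i) + 2))]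
      simp
    rw [← ht, Finset.mul_sum, ← Finset.sum_add_distrib]
    refine Finset.sum_congr rfl fun i hi => ?_
    rw [Finset.mem_range] at hi
    obtain ⟨d, rfl⟩ : ∃ d, n = i + 1 + d := ⟨n - (i + 1), by omega⟩
    rw [show 4 * (i + 1 + d + 1 - i) - 2 = 4 * (d + 1) + 2 by omega,
      show 4 * (i + 1 + d + 1 - i) - 4 = 4 * d + 4 by omega,
      show i + 1 + d - (i + 1) = d by omega, show i + 1 + d - i = d + 1 by omega,
      show 4 * i + 7 = 4 * (i + 1) + 3 by ring, footCoord_add_five, footCoord_add_two,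
      footCoord_add_three, footCoord_add_four]
    ring
  rw [hs, show 4 * n + 8 = 4 * (n + 1) + 4 by ring, show 4 * n + 6 = 4 * (n + 1) + 2 by ring,
    show 4 * n + 9 = 4 * (n + 1) + 5 by ring, show 4 * n + 10 = 4 * (n + 2) + 2 by ring,
    show 4 * n + 7 = 4 * (n + 1) + 3 by ring]
  have f2 : footCoord l 2 = -l 2 := footCoord_add_two l 0
  have f3 : footCoord l 3 = -l 3 := footCoord_add_three l 0
  simp only [footCoord_one, f2, f3, footCoord_add_two, footCoord_add_four, footCoord_add_five]
  ring

/-- Truncating to k coordinates preserves values only at indices 1, …, k; the invariant r = n + 3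
reaches no further than 4r - 2 = 4n + 10, which is at most k when r ≤ t. -/
theorem seqInvariant_congr {f g : ℕ → F} {n : ℕ}
    (h : ∀ i, 1 ≤ i → i ≤ 4 * n + 10 → f i = g i) :
    seqInvariant f (n + 3) = seqInvariant g (n + 3) := by
  have hs : ∀ i ∈ Finset.range n,
      -(f (4 * i + 5) * f (4 * (n + 1 - i) - 2)) + f (4 * i + 7) * f (4 * (n + 1 - i) - 4) =
      -(g (4 * i + 5) * g (4 * (n + 1 - i) - 2)) + g (4 * i + 7) * g (4 * (n + 1 - i) - 4) := by
    intro i hi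
    rw [Finset.mem_range] at hi
    rw [h (4 * i + 5) (by omega) (by omega), h (4 * i + 7) (by omega) (by omega),
      h (4 * (n + 1 - i) - 2) (by omega) (by omega), h (4 * (n + 1 - i) - 4) (by omega) (by omega)]
  rw [seqInvariant_add_three, seqInvariant_add_three, Finset.sum_congr rfl hs,
    h 1 (by omega) (by omega), h 2 (by omega) (by omega), h 3 (by omega) (by omega),
    h (4 * n + 4) (by omega) (by omega), h (4 * n + 5) (by omega) (by omega),
    h (4 * n + 6) (by omega) (by omega), h (4 * n + 8) (by omega) (by omega),
    h (4 * n + 9) (by omega) (by omega), h (4 * n + 10) (by omega) le_rfl]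

/-- The invariants of a line agree with those of its neighbour with first coordinate zero. -/
theorem pointInvariant_footCoord (hk : 6 ≤ k) (l : Fin k → F) {r : ℕ} (h2 : 2 ≤ r)
    (hr : r ≤ tNum k) :
    pointInvariant (vec k (footCoord (coord l))) r = lineInvariant l r := by
  unfold tNum at hr
  obtain rfl | ⟨n, rfl⟩ : r = 2 ∨ ∃ n, r = n + 3 := by
    rcases h2.eq_or_lt with h | h
    · exact Or.inl h.symm
    · exact Or.inr ⟨r - 3, by omega⟩
  · rw [pointInvariant_two, coord_vec _ (by omega) (by omega), coord_vec _ (by omega) (by omega),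
      coord_vec _ (by omega) (by omega), coord_vec _ (by omega) (by omega),
      coord_vec _ (by omega) (by omega)]
    simp [footCoord, lineInvariant]
    ring
  · have hl : lineInvariant l (n + 3) = (-1) ^ (n + 2) * seqLineInvariant (coord l) (n + 3) := by
      rw [lineInvariant, if_neg (by omega)]; rfl
    rw [hl, pointInvariant_add_three, ← seqInvariant_footCoord]
    congr 1
    exact seqInvariant_congr fun i h1 hi => coord_vec _ h1 (by omega)

end DGraph

theorem theoremS {F : Type*} [Field F] [Fintype F] (hq3 : 3 ≤ Fintype.card F)
    (hq4 : Fintype.card F ≠ 4) (k : ℕ) (hk : 6 ≤ k) (v : DGraph.Vertex F k)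
    (hv : DGraph.invariantVector v = 0) : v ∈ (DGraph.zeroComponent F k).supp := by
  rw [SimpleGraph.ConnectedComponent.mem_supp_iff, DGraph.zeroComponent,
    SimpleGraph.ConnectedComponent.eq]
  cases v with
  | point p =>
    refine (DGraph.reachable_point hq3 hq4 (by omega) p fun r h2 hr => ?_).symm
    exact congrFun hv ⟨r, Finset.mem_Icc.2 ⟨h2, hr⟩⟩
  | line l =>
    have hadj : (DGraph.graph F k).Adj (DGraph.Vertex.line l)
        (DGraph.Vertex.point (DGraph.vec k (DGraph.footCoord (DGraph.coord l)))) := by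
      have h := DGraph.incident_footCoord (k := k) (DGraph.coord l)
      rw [DGraph.vec_coord] at h
      exact h
    refine hadj.reachable.trans (DGraph.reachable_point hq3 hq4 (by omega) _ fun r h2 hr => ?_).symm
    rw [DGraph.pointInvariant_footCoord hk l h2 hr]
    exact congrFun hv ⟨r, Finset.mem_Icc.2 ⟨h2, hr⟩⟩
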